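/- Let $V$ be a finite-dimensional real vector space with a rational structure $V(\mathbb{Q})$ (a $\mathbb{Q}$-subspace of $V$ for which $\mathbb{R}\otimes_{\mathbb{Q}}V(\mathbb{Q})\to V$ is an isomorphism), and let $C\subset V$ be a nonempty open convex cone (invariant under multiplication with positive scalars) which is nondegenerate, i.e. contains no affine line. Let $C_+$ be the convex hull of $\overline{C}\cap V(\mathbb{Q})$. For a subgroup $\Gamma\subset \mathrm{GL}(V)$, the pair $(C_+,\Gamma)$ is said to be of polyhedral type if $\Gamma$ stabilizes $C$, $\Gamma$ stabilizes some lattice of $V$ contained in $V(\mathbb{Q})$, and there is a polyhedral cone $\Pi\subset C_+$ (a nonempty set defined by finitely many affine-linear inequalities and invariant under multiplication with positive scalars) such that $\Gamma\cdot\Pi=C_+$. Suppose that $(C_+,\Gamma)$ is of polyhedral type, and let $\Gamma'$ be a subgroup of $\mathrm{GL}(V(\mathbb{Q}))$ (i.e. a subgroup of $\mathrm{GL}(V)$ stabilizing $V(\mathbb{Q})$) which stabilizes $C$. Then $(C_+,\Gamma')$ is of polyhedral type if and only if $\Gamma'$ is commensurable with $\Gamma$, i.e. if and only if $\Gamma\cap\Gamma'$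 is of finite index in both $\Gamma$ and $\Gamma'$. -/

import Mathlib

/-- `VQ` is a rational structure on the real vector space `V`: a `ℚ`-subspace of `V` such that the
natural map `ℝ ⊗[ℚ] VQ → V` is an isomorphism. -/
def IsRationalStructure {V : Type*} [AddCommGroup V] [Module ℝ V] [Module ℚ V]
    (VQ : Submodule ℚ V) : Prop :=
  IsBaseChange ℝ VQ.subtype

/-- A set is nondegenerate if it contains no affine line. -/
def IsNondegenerateSet {V : Type*} [AddCommGroup V] [Module ℝ V] (X : Set V) : Prop :=
  ¬ ∃ x v : V, v ≠ 0 ∧ ∀ t : ℝ, x + t • v ∈ X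

/-- A polyhedron: a subset that can be defined by finitely many affine-linear inequalities. -/
def IsPolyhedron {V : Type*} [AddCommGroup V] [Module ℝ V] (X : Set V) : Prop :=
  ∃ Φ : Set (V →ᵃ[ℝ] ℝ), Φ.Finite ∧ X = {x | ∀ f ∈ Φ, 0 ≤ f x}

/-- A polyhedral cone: a polyhedron that is a cone, i.e. that is nonempty and invariant under
multiplication with positive scalars. -/
structure IsPolyhedralCone {V : Type*} [AddCommGroup V] [Module ℝ V] (X : Set V) : Prop where
  isPolyhedron : IsPolyhedron X
  nonempty : X.Nonempty
  smul_mem : ∀ c : ℝ, 0 < c → ∀ x ∈ X, c • x ∈ X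

/-- `L` is a lattice of `V` contained in the rational structure `VQ`. -/
structure IsRationalLattice {V : Type*} [NormedAddCommGroup V] [NormedSpace ℝ V] [Module ℚ V]
    (VQ : Submodule ℚ V) (L : Submodule ℤ V) : Prop where
  subset : (L : Set V) ⊆ (VQ : Set V)
  discrete : DiscreteTopology L
  isZLattice : IsZLattice ℝ L

/-- The cone `C₊`: the convex hull of the set of rational points of the closure of `C`. -/
def rationalHull {V : Type*} [NormedAddCommGroup V] [NormedSpace ℝ V] [Module ℚ V]
    (VQ : Submodule ℚ V) (C : ConvexCone ℝ V) : Set V :=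
  convexHull ℝ (closure (C : Set V) ∩ (VQ : Set V))

/-- The group `Γ` of linear automorphisms stabilizes the set `X`. -/
def StabilizesSet {V : Type*} [AddCommGroup V] [Module ℝ V]
    (Γ : Subgroup (V ≃ₗ[ℝ] V)) (X : Set V) : Prop :=
  ∀ γ ∈ Γ, γ '' X = X

/-- The pair `(C₊, Γ)` is of polyhedral type: `Γ` stabilizes `C` and some lattice contained in
`VQ`, and there is a polyhedral cone `Π` in `C₊` with `Γ · Π = C₊`. -/
structure IsPolyhedralType {V : Type*} [NormedAddCommGroup V] [NormedSpace ℝ V] [Module ℚ V]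
    (VQ : Submodule ℚ V) (C : ConvexCone ℝ V) (Γ : Subgroup (V ≃ₗ[ℝ] V)) : Prop where
  stabilizes_cone : StabilizesSet Γ (C : Set V)
  stabilizes_lattice : ∃ L : Submodule ℤ V, IsRationalLattice VQ L ∧ StabilizesSet Γ (L : Set V)
  exists_polyhedralCone : ∃ P : Set V, IsPolyhedralCone P ∧ P ⊆ rationalHull VQ C ∧
    ⋃ γ ∈ Γ, γ '' P = rationalHull VQ C

/-! Let `G_L` be the stabilizer of `C` and of a lattice `L` in `VQ`. A group of polyhedral type has
finite index in some `G_L`, and any two `G_L` are commensurable; hence so are any two groups of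
polyhedral type.

For the finite index, order `V` by the closure of `C`, a closed salient cone. Choose a lattice point
`X` of `C` so deep that the lattice points between `0` and `X` span `V`. `Γ` moves every orbit point
`g X` into one cone spanned by finitely many lattice points. By Dickson's lemma the lattice points
of that cone are well quasi-ordered, whereas a `G_L`-orbit is an antichain, so finitely many orbit
points remain. Order intervals contain finitely many lattice points, so finitely many `g` lead to
each of them (`relIndex_pairStabilizer_ne_zero_of_cover`).

Conversely, the sums of finitely many translates of the lattice and of the cone for `Γ` serve for
`Γ'`. -/

/-! ### Polyhedral cones: generators versus inequalities -/

open PointedCone in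
-- Double description: keep the generators with `f ≥ 0`, and for each pair of opposite signs add its
-- combination on `f = 0`.
theorem PointedCone.FG.exists_inter_halfspace {V : Type*} [AddCommGroup V] [Module ℝ V]
    {D : PointedCone ℝ V} (hD : D.FG) (f : V →ₗ[ℝ] ℝ) :
    ∃ E : PointedCone ℝ V, E.FG ∧ ∀ x, x ∈ E ↔ x ∈ D ∧ 0 ≤ f x := by
  obtain ⟨S, hSfin, rfl⟩ := Submodule.fg_def.1 hD
  set S₁ := {s ∈ S | 0 ≤ f s}
  set S₂ := {s ∈ S | f s < 0}
  set T := S₁ ∪ (fun p : V × V => f p.1 • p.2 - f p.2 • p.1) '' (S₁ ×ˢ S₂)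
  have hS₁ : S₁.Finite := hSfin.subset (Set.sep_subset _ _)
  have hS₂ : S₂.Finite := hSfin.subset (Set.sep_subset _ _)
  have hS : S = S₁ ∪ S₂ := by
    ext s
    simp only [S₁, S₂, Set.mem_union, Set.mem_ofPred_eq, ← and_or_left, le_or_gt, and_true]
  have hS₁T : hull ℝ S₁ ≤ hull ℝ T := Submodule.span_mono Set.subset_union_left
  refine ⟨hull ℝ T, Submodule.fg_def.2 ⟨T, hS₁.union ((hS₁.prod hS₂).image _), rfl⟩, fun x =>
    ⟨fun hx => ?_, fun ⟨hx, hfx⟩ => ?_⟩⟩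
  · induction hx using Submodule.span_induction with
    | mem x hx =>
      rcases hx with hx | ⟨⟨a, b⟩, ⟨ha, hb⟩, rfl⟩
      · exact ⟨subset_hull hx.1, hx.2⟩
      · refine ⟨?_, by simp [mul_comm]⟩
        simp only [sub_eq_add_neg, ← neg_smul]
        exact add_mem (PointedCone.smul_mem _ ha.2 (subset_hull hb.1))
          (PointedCone.smul_mem _ (neg_nonneg.2 hb.2.le) (subset_hull ha.1))
    | zero => simp
    | add x y _ _ hx hy => exact ⟨add_mem hx.1 hy.1, by rw [map_add]; exact add_nonneg hx.2 hy.2⟩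
    | smul c x _ hx =>
      refine ⟨Submodule.smul_mem _ _ hx.1, ?_⟩
      change 0 ≤ f ((c : ℝ) • x)
      rw [map_smul]
      exact mul_nonneg c.2 hx.2
  · rw [hS, Submodule.span_union] at hx
    obtain ⟨a, ha, b, hb, rfl⟩ := Submodule.mem_sup.1 hx
    have hpair : ∀ a ∈ hull ℝ S₁, ∀ b ∈ hull ℝ S₂, f a • b - f b • a ∈ hull ℝ T := by
      intro a ha b hb
      induction ha using Submodule.span_induction with
      | mem a ha =>
        induction hb using Submodule.span_induction with
        | mem b hb => exact subset_hull (Or.inr ⟨(a, b), ⟨ha, hb⟩, rfl⟩)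
        | zero => simp
        | add x y _ _ hx hy =>
          convert add_mem hx hy using 1
          rw [map_add]
          module
        | smul c x _ hx =>
          convert Submodule.smul_mem _ c hx using 1
          change f a • (c : ℝ) • x - f ((c : ℝ) • x) • a = (c : ℝ) • (f a • x - f x • a)
          rw [map_smul, smul_eq_mul]
          module
      | zero => simp
      | add x y _ _ hx hy =>
        convert add_mem hx hy using 1
        rw [map_add]
        module
      | smul c x _ hx =>
        convert Submodule.smul_mem _ c hx using 1
        change f ((c : ℝ) • x) • b - f b • (c : ℝ) • x = (c : ℝ) • (f x • b - f b • x)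
        rw [map_smul, smul_eq_mul]
        module
    have hneg : ∀ b ∈ hull ℝ S₂, b = 0 ∨ f b < 0 := by
      intro b hb
      induction hb using Submodule.span_induction with
      | mem b hb => exact Or.inr hb.2
      | zero => exact Or.inl rfl
      | add x y _ _ hx hy =>
        rcases hx with rfl | hx
        · simpa using hy
        · rcases hy with rfl | hy
          · simpa using Or.inr hx
          · exact Or.inr (by rw [map_add]; exact add_neg hx hy)
      | smul c x _ hx =>
        rcases hx with rfl | hx
        · simp
        · rcases c.2.eq_or_lt with hc | hc
          · left
            change (c : ℝ) • x = 0
            rw [← hc, zero_smul]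
          · right
            change f ((c : ℝ) • x) < 0
            rw [map_smul]
            exact mul_neg_of_pos_of_neg hc hx
    rcases hneg b hb with rfl | hneg
    · simpa using hS₁T ha
    · rw [map_add] at hfx
      have hfa : 0 < f a := by linarith
      -- Slide `b` along `a` onto `f = 0`; what is left of `a` has coefficient `f (a + b) / f a ≥
      -- 0`.
      have key : a + b = (f a)⁻¹ • (f a • b - f b • a) + ((f a + f b) * (f a)⁻¹) • a := by
        rw [smul_sub, smul_smul, smul_smul, inv_mul_cancel₀ hfa.ne', add_mul,
          mul_inv_cancel₀ hfa.ne']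
        module
      rw [key]
      exact add_mem (PointedCone.smul_mem _ (by positivity) (hpair a ha b hb))
        (PointedCone.smul_mem _ (by positivity) (hS₁T ha))

theorem PointedCone.exists_fg_of_finite_halfspaces {V : Type*} [AddCommGroup V] [Module ℝ V]
    [FiniteDimensional ℝ V] {Φ : Set (V →ₗ[ℝ] ℝ)} (hΦ : Φ.Finite) :
    ∃ E : PointedCone ℝ V, E.FG ∧ ∀ x, x ∈ E ↔ ∀ f ∈ Φ, 0 ≤ f x := by
  induction Φ, hΦ using Set.Finite.induction_on with
  | empty => exact ⟨⊤, Module.Finite.fg_top, by simp⟩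
  | @insert f Φ _ _ ih =>
    obtain ⟨D, hD, hDΦ⟩ := ih
    obtain ⟨E, hE, hED⟩ := PointedCone.FG.exists_inter_halfspace hD f
    refine ⟨E, hE, fun x => ?_⟩
    rw [hED, hDΦ, Set.forall_mem_insert, and_comm]

theorem IsPolyhedralCone.exists_fg {V : Type*} [AddCommGroup V] [Module ℝ V]
    [FiniteDimensional ℝ V] {P : Set V} (hP : IsPolyhedralCone P) :
    ∃ E : PointedCone ℝ V, E.FG ∧ (E : Set V) = P := by
  obtain ⟨⟨Φ, hΦ, rfl⟩, ⟨x₀, hx₀⟩, hsmul⟩ := hP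
  have hlin : ∀ (f : V →ᵃ[ℝ] ℝ) (x : V), f x = f.linear x + f 0 := fun f x => by
    simpa using f.map_vadd 0 x
  -- Let `t → ∞` and `t → 0` in `0 ≤ t * f.linear x + f 0`: the linear parts alone define the cone.
  have hcone : ∀ f ∈ Φ, ∀ x ∈ {x | ∀ f ∈ Φ, 0 ≤ f x}, 0 ≤ f.linear x ∧ 0 ≤ f 0 := by
    intro f hf x hx
    have h : ∀ t : ℝ, 0 < t → 0 ≤ t * f.linear x + f 0 := fun t ht => by
      have := hsmul t ht x hx f hf
      rwa [hlin, map_smul, smul_eq_mul] at this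
    constructor
    · by_contra! hneg
      have h1 : 0 < (|f 0| + 1) / (-f.linear x) := div_pos (by positivity) (by linarith)
      have h2 := h _ h1
      rw [div_mul_eq_mul_div, div_neg, mul_div_assoc, div_self hneg.ne] at h2
      linarith [le_abs_self (f 0)]
    · by_contra! hneg
      have h1 : 0 < (-f 0 / 2) / (|f.linear x| + 1) := div_pos (by linarith) (by positivity)
      have h2 := h _ h1
      have h3 : (-f 0 / 2) / (|f.linear x| + 1) * f.linear x ≤ -f 0 / 2 := by
        rw [div_mul_eq_mul_div, div_le_iff₀ (by positivity)]
        nlinarith [le_abs_self (f.linear x)]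
      linarith
  obtain ⟨E, hE, hEΦ⟩ := PointedCone.exists_fg_of_finite_halfspaces
    (hΦ.image fun f : V →ᵃ[ℝ] ℝ => f.linear)
  refine ⟨E, hE, Set.ext fun x => ?_⟩
  rw [SetLike.mem_coe, hEΦ, Set.forall_mem_image]
  refine ⟨fun h f hf => ?_, fun h f hf => (hcone f hf x h).1⟩
  rw [hlin]
  exact add_nonneg (h hf) (hcone f hf x₀ hx₀).2

theorem exists_between_of_finite {α : Type*} [LinearOrder α] [Nonempty α] {A B : Set α}
    (hA : A.Finite) (hB : B.Finite) (h : ∀ a ∈ A, ∀ b ∈ B, a ≤ b) :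
    ∃ t, (∀ a ∈ A, a ≤ t) ∧ ∀ b ∈ B, t ≤ b := by
  rcases A.eq_empty_or_nonempty with rfl | hAne
  · obtain ⟨t, ht⟩ := hB.bddBelow
    exact ⟨t, by simp, fun b hb => ht hb⟩
  · obtain ⟨t, htA, ht⟩ := Set.exists_max_image A id hA hAne
    exact ⟨t, ht, fun b hb => h t htA b hb⟩

open PointedCone in
-- Fourier–Motzkin elimination of `t` from `x - t • v ∈ D`: each `f` bounds `t` from below or above
-- according to the sign of `f v`, and the new functionals compare these bounds.
theorem PointedCone.exists_halfspaces_sup_ray {V : Type*} [AddCommGroup V] [Module ℝ V]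
    {D : PointedCone ℝ V} {Φ : Set (V →ₗ[ℝ] ℝ)} (hΦ : Φ.Finite)
    (hD : ∀ x, x ∈ D ↔ ∀ f ∈ Φ, 0 ≤ f x) (v : V) :
    ∃ Ψ : Set (V →ₗ[ℝ] ℝ), Ψ.Finite ∧ ∀ x, x ∈ hull ℝ {v} ⊔ D ↔ ∀ f ∈ Ψ, 0 ≤ f x := by
  set Φ₁ := {f ∈ Φ | 0 ≤ f v}
  set Φ₂ := {f ∈ Φ | f v < 0}
  have hΦ₁ : Φ₁.Finite := hΦ.subset (Set.sep_subset _ _)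
  have hΦ₂ : Φ₂.Finite := hΦ.subset (Set.sep_subset _ _)
  refine ⟨Φ₁ ∪ (fun p : (V →ₗ[ℝ] ℝ) × (V →ₗ[ℝ] ℝ) => p.1 v • p.2 - p.2 v • p.1) '' (Φ₁ ×ˢ Φ₂),
    hΦ₁.union ((hΦ₁.prod hΦ₂).image _), fun x => ?_⟩
  have hmem : x ∈ hull ℝ {v} ⊔ D ↔ ∃ t : ℝ, 0 ≤ t ∧ x - t • v ∈ D := by
    rw [Submodule.mem_sup]
    constructor
    · rintro ⟨y, hy, z, hz, rfl⟩
      obtain ⟨t, rfl⟩ := Submodule.mem_span_singleton.1 hy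
      refine ⟨t, t.2, ?_⟩
      change (t : ℝ) • v + z - (t : ℝ) • v ∈ D
      rwa [add_sub_cancel_left]
    · rintro ⟨t, ht, hx⟩
      exact ⟨t • v, PointedCone.smul_mem _ ht (subset_hull rfl), _, hx, by abel⟩
  rw [hmem]
  constructor
  · rintro ⟨t, ht, hx⟩
    have h : ∀ f ∈ Φ, t * f v ≤ f x := fun f hf => by
      have := (hD _).1 hx f hf
      rw [map_sub, map_smul, smul_eq_mul] at this
      linarith
    rintro f (hf | ⟨⟨f, g⟩, ⟨hf, hg⟩, rfl⟩)
    · exact (mul_nonneg ht hf.2).trans (h f hf.1)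
    · have h1 := h f hf.1
      have h2 := h g hg.1
      have h3 := hf.2
      have h4 := hg.2
      simp only [LinearMap.sub_apply, LinearMap.smul_apply, smul_eq_mul]
      nlinarith [mul_le_mul_of_nonneg_left h2 h3, mul_le_mul_of_nonneg_left h1 (neg_nonneg.2 h4.le)]
  · intro h
    have h1 : ∀ f ∈ Φ₁, 0 ≤ f x := fun f hf => h f (Or.inl hf)
    have h2 : ∀ f ∈ Φ₁, ∀ g ∈ Φ₂, 0 ≤ f v * g x - g v * f x := fun f hf g hg => by
      simpa using h _ (Or.inr ⟨(f, g), ⟨hf, hg⟩, rfl⟩)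
    -- The inserted `0` encodes `0 ≤ t`.
    obtain ⟨t, htA, htB⟩ := exists_between_of_finite
      (A := insert 0 ((fun g : V →ₗ[ℝ] ℝ => g x / g v) '' Φ₂))
      (B := (fun f : V →ₗ[ℝ] ℝ => f x / f v) '' {f ∈ Φ₁ | 0 < f v})
      ((hΦ₂.image _).insert _) ((hΦ₁.subset (Set.sep_subset _ _)).image _) (by
        rw [Set.forall_mem_insert, Set.forall_mem_image, Set.forall_mem_image]
        refine ⟨fun f hf => div_nonneg (h1 f hf.1) hf.2.le, fun g hg => ?_⟩
        rw [Set.forall_mem_image]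
        intro f hf
        have := h2 f hf.1 g hg
        rw [div_le_iff_of_neg hg.2, div_mul_eq_mul_div, div_le_iff₀ hf.2]
        linarith)
    rw [Set.forall_mem_insert, Set.forall_mem_image] at htA
    rw [Set.forall_mem_image] at htB
    refine ⟨t, htA.1, (hD _).2 fun f hf => ?_⟩
    rw [map_sub, map_smul, smul_eq_mul, sub_nonneg]
    rcases lt_trichotomy (f v) 0 with hv | hv | hv
    · exact (div_le_iff_of_neg hv).1 (htA.2 ⟨hf, hv⟩)
    · rw [hv, mul_zero]
      exact h1 f ⟨hf, hv.ge⟩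
    · exact (le_div_iff₀ hv).1 (htB ⟨⟨hf, hv.le⟩, hv⟩)

open PointedCone in
theorem PointedCone.exists_halfspaces_of_finite {V : Type*} [AddCommGroup V] [Module ℝ V]
    [FiniteDimensional ℝ V] {S : Set V} (hS : S.Finite) :
    ∃ Φ : Set (V →ₗ[ℝ] ℝ), Φ.Finite ∧ ∀ x, x ∈ hull ℝ S ↔ ∀ f ∈ Φ, 0 ≤ f x := by
  induction S, hS using Set.Finite.induction_on with
  | empty =>
    let b := Module.finBasis ℝ V
    refine ⟨Set.range b.coord ∪ Set.range fun i => -b.coord i,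
      (Set.finite_range _).union (Set.finite_range _), fun x => ?_⟩
    rw [PointedCone.hull, Submodule.span_empty, Submodule.mem_bot]
    refine ⟨by rintro rfl; simp, fun h => b.ext_elem fun i => ?_⟩
    rw [map_zero]
    apply le_antisymm
    · simpa using h _ (Or.inr ⟨i, rfl⟩)
    · simpa using h _ (Or.inl ⟨i, rfl⟩)
  | @insert v S _ _ ih =>
    obtain ⟨Φ, hΦ, hΦS⟩ := ih
    rw [PointedCone.hull, Submodule.span_insert]
    exact PointedCone.exists_halfspaces_sup_ray hΦ hΦS v

theorem PointedCone.FG.isPolyhedralCone {V : Type*} [AddCommGroup V] [Module ℝ V]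
    [FiniteDimensional ℝ V] {E : PointedCone ℝ V} (hE : E.FG) :
    IsPolyhedralCone (E : Set V) := by
  obtain ⟨S, hS, rfl⟩ := Submodule.fg_def.1 hE
  obtain ⟨Φ, hΦ, hΦS⟩ := PointedCone.exists_halfspaces_of_finite hS
  refine ⟨⟨LinearMap.toAffineMap '' Φ, hΦ.image _, ?_⟩, ⟨0, zero_mem _⟩,
    fun c hc x hx => PointedCone.smul_mem _ hc.le hx⟩
  ext x
  rw [SetLike.mem_coe, hΦS, Set.mem_ofPred_eq, Set.forall_mem_image]
  rfl

/-! ### Lattices in the rational structure -/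

/-- A `ℤ`-basis of `L` is independent over `ℚ` and has `dim V = dim VQ` elements, so it spans `VQ`;
clear denominators. -/
theorem IsRationalLattice.exists_nsmul_mem {V : Type*} [NormedAddCommGroup V] [NormedSpace ℝ V]
    [FiniteDimensional ℝ V] [Module ℚ V] {VQ : Submodule ℚ V} (hVQ : IsRationalStructure VQ)
    {L : Submodule ℤ V} (hL : IsRationalLattice VQ L) {v : V} (hv : v ∈ VQ) :
    ∃ N : ℕ, 0 < N ∧ N • v ∈ L := by
  have := hL.discrete
  have := hL.isZLattice
  have := ZLattice.module_free ℝ L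
  have := ZLattice.module_finite ℝ L
  let b := Module.Free.chooseBasis ℤ L
  let bR := b.ofZLatticeBasis ℝ L
  let β := Module.Basis.ofVectorSpace ℚ VQ
  let βR : Module.Basis _ ℝ V := IsBaseChange.basis β hVQ
  have := Module.Finite.finite_basis βR
  have := Fintype.ofFinite (Module.Basis.ofVectorSpaceIndex ℚ VQ)
  have : FiniteDimensional ℚ VQ := Module.Finite.of_basis β
  let w : Module.Free.ChooseBasisIndex ℤ L → VQ := fun i => ⟨b i, hL.subset (b i).2⟩
  have hw : LinearIndependent ℚ w := by
    refine LinearIndependent.of_comp VQ.subtype ?_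
    have h := bR.linearIndependent.restrict_scalars (R := ℚ)
      (fun x y h => by simpa [Rat.smul_def] using h)
    convert h using 1
    ext i
    simp [bR, w]
  have hcard : Fintype.card (Module.Free.ChooseBasisIndex ℤ L) = Module.finrank ℚ VQ := by
    rw [Module.finrank_eq_card_basis β, ← Module.finrank_eq_card_basis βR,
      Module.finrank_eq_card_basis bR]
  have hspan := hw.span_eq_top_of_card_eq_finrank' hcard
  have key : ∀ x : VQ, x ∈ Submodule.span ℚ (Set.range w) → ∃ N : ℕ, 0 < N ∧ N • (x : V) ∈ L := by
    intro x hx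
    induction hx using Submodule.span_induction with
    | mem x hx =>
      obtain ⟨i, rfl⟩ := hx
      exact ⟨1, one_pos, by simp [w]⟩
    | zero => exact ⟨1, one_pos, by simp⟩
    | add x y _ _ hx hy =>
      obtain ⟨M, hM, hx⟩ := hx
      obtain ⟨N, hN, hy⟩ := hy
      refine ⟨M * N, mul_pos hM hN, ?_⟩
      rw [Submodule.coe_add, smul_add, mul_smul M N (y : V), mul_comm, mul_smul]
      exact add_mem (nsmul_mem hx N) (nsmul_mem hy M)
    | smul q x _ hx =>
      obtain ⟨N, hN, hx⟩ := hx
      refine ⟨q.den * N, mul_pos q.pos hN, ?_⟩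
      have h : (q.den * N) • ((q • x : VQ) : V) = q.num • N • (x : V) := by
        rw [Submodule.coe_smul, ← Nat.cast_smul_eq_nsmul ℚ, ← Nat.cast_smul_eq_nsmul ℚ,
          ← Int.cast_smul_eq_zsmul ℚ, smul_smul, smul_smul]
        congr 1
        push_cast
        rw [← Rat.den_mul_eq_num q]
        ring
      rw [h]
      exact zsmul_mem hx _
  exact key ⟨v, hv⟩ (hspan ▸ Submodule.mem_top)

theorem IsRationalLattice.exists_nsmul_mem_of_fg {V : Type*} [NormedAddCommGroup V]
    [NormedSpace ℝ V] [FiniteDimensional ℝ V] [Module ℚ V] {VQ : Submodule ℚ V}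
    (hVQ : IsRationalStructure VQ) {L : Submodule ℤ V} (hL : IsRationalLattice VQ L)
    {M : Submodule ℤ V} (hM : M.FG) (hMQ : (M : Set V) ⊆ VQ) :
    ∃ N : ℕ, 0 < N ∧ ∀ x ∈ M, N • x ∈ L := by
  obtain ⟨S, hS, rfl⟩ := Submodule.fg_def.1 hM
  have hSQ : S ⊆ VQ := Submodule.subset_span.trans hMQ
  clear hM hMQ
  induction S, hS using Set.Finite.induction_on with
  | empty => exact ⟨1, one_pos, by simp⟩
  | @insert v S _ _ ih =>
    obtain ⟨M, hM, hS⟩ := ih ((Set.subset_insert _ _).trans hSQ)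
    obtain ⟨N, hN, hv⟩ := hL.exists_nsmul_mem hVQ (hSQ (Set.mem_insert _ _))
    refine ⟨M * N, mul_pos hM hN, fun x hx => ?_⟩
    obtain ⟨a, y, hy, rfl⟩ := Submodule.mem_span_insert.1 hx
    rw [smul_add, mul_smul, mul_comm M N, mul_smul, smul_comm N a]
    exact add_mem (nsmul_mem (zsmul_mem hv a) _) (nsmul_mem (hS y hy) _)

theorem IsRationalLattice.fg {V : Type*} [NormedAddCommGroup V] [NormedSpace ℝ V]
    [FiniteDimensional ℝ V] [Module ℚ V] {VQ : Submodule ℚ V} {L : Submodule ℤ V}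
    (hL : IsRationalLattice VQ L) : L.FG := by
  have := hL.discrete
  have := hL.isZLattice
  exact ZLattice.FG ℝ L

theorem Submodule.finite_inter_of_isBounded {V : Type*} [NormedAddCommGroup V] [NormedSpace ℝ V]
    [FiniteDimensional ℝ V] (L : Submodule ℤ V) [DiscreteTopology L] {B : Set V}
    (hB : Bornology.IsBounded B) : (B ∩ L).Finite := by
  have := FiniteDimensional.proper ℝ V
  refine Metric.finite_isBounded_inter_isClosed DiscreteTopology.isDiscrete hB ?_
  have : DiscreteTopology L.toAddSubgroup := ‹DiscreteTopology L›
  exact AddSubgroup.isClosed_of_discrete (H := L.toAddSubgroup)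

theorem ZLattice.exists_norm_sub_le {V : Type*} [NormedAddCommGroup V] [NormedSpace ℝ V]
    [FiniteDimensional ℝ V] (L : Submodule ℤ V) [DiscreteTopology L] [IsZLattice ℝ L] :
    ∃ R : ℝ, 0 ≤ R ∧ ∀ v : V, ∃ x ∈ L, ‖v - x‖ ≤ R := by
  have := ZLattice.module_free ℝ L
  have := ZLattice.module_finite ℝ L
  let b := (Module.Free.chooseBasis ℤ L).ofZLatticeBasis ℝ L
  refine ⟨∑ i, ‖b i‖, Finset.sum_nonneg fun i _ => norm_nonneg _, fun v =>
    ⟨ZSpan.floor b v, (Module.Basis.ofZLatticeBasis_span ℝ L _).le (ZSpan.floor b v).2,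
      ZSpan.norm_fract_le b v⟩⟩

/-! ### Open cones and the order of their closure -/

/-- Balls in `C` grow under scaling, while the distance to `L` stays bounded. -/
theorem ConvexCone.exists_mem_lattice_forall_add_mem {V : Type*} [NormedAddCommGroup V]
    [NormedSpace ℝ V] [FiniteDimensional ℝ V] {C : ConvexCone ℝ V} (hne : (C : Set V).Nonempty)
    (hopen : IsOpen (C : Set V)) (L : Submodule ℤ V) [DiscreteTopology L] [IsZLattice ℝ L]
    (r : ℝ) : ∃ x ∈ L, ∀ w : V, ‖w‖ ≤ r → x + w ∈ C := by
  obtain ⟨c, hc⟩ := hne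
  obtain ⟨ε, hε, hball⟩ := Metric.isOpen_iff.1 hopen c hc
  obtain ⟨R, hR, hL⟩ := ZLattice.exists_norm_sub_le L
  obtain ⟨N, hN⟩ := exists_nat_gt ((R + |r|) / ε)
  have hN0 : (0 : ℝ) < N := lt_of_le_of_lt (by positivity) hN
  obtain ⟨x, hx, hxR⟩ := hL ((N : ℝ) • c)
  refine ⟨x, hx, fun w hw => ?_⟩
  have key : x + w = (N : ℝ) • (c + (N : ℝ)⁻¹ • (w - ((N : ℝ) • c - x))) := by
    rw [smul_add, smul_inv_smul₀ hN0.ne']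
    abel
  rw [key]
  refine C.smul_mem hN0 (hball ?_)
  rw [mem_ball_iff_norm, add_sub_cancel_left, norm_smul, norm_inv, Real.norm_natCast,
    inv_mul_lt_iff₀ hN0]
  rw [div_lt_iff₀ hε] at hN
  calc _ ≤ ‖w‖ + ‖(N : ℝ) • c - x‖ := norm_sub_le _ _
    _ < N * ε := by linarith [le_abs_self r]

theorem ConvexCone.add_mem_of_mem_closure {V : Type*} [NormedAddCommGroup V] [NormedSpace ℝ V]
    {C : ConvexCone ℝ V} (hopen : IsOpen (C : Set V)) {c k : V} (hc : c ∈ C)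
    (hk : k ∈ closure (C : Set V)) : c + k ∈ C := by
  obtain ⟨k', hk', hC⟩ := mem_closure_iff.1 hk ((fun x => c + k - x) ⁻¹' C)
    (hopen.preimage (by fun_prop)) (by simpa using hc)
  have := C.add_mem hk' hC
  rwa [sub_add_cancel] at this

theorem ConvexCone.zero_mem_closure {V : Type*} [NormedAddCommGroup V] [NormedSpace ℝ V]
    {C : ConvexCone ℝ V} (hne : (C : Set V).Nonempty) : (0 : V) ∈ closure (C : Set V) := by
  obtain ⟨c, hc⟩ := hne
  have h : Filter.Tendsto (fun t : ℝ => t • c) (nhdsWithin 0 (Set.Ioi 0)) (nhds 0) := by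
    have : Filter.Tendsto (fun t : ℝ => t • c) (nhds 0) (nhds ((0 : ℝ) • c)) :=
      (by fun_prop : Continuous fun t : ℝ => t • c).tendsto 0
    rw [zero_smul] at this
    exact this.mono_left nhdsWithin_le_nhds
  exact mem_closure_of_tendsto h (Filter.eventually_of_mem self_mem_nhdsWithin
    fun t ht => C.smul_mem ht hc)

theorem ConvexCone.exists_pointedCone_coe_eq_closure {V : Type*} [NormedAddCommGroup V]
    [NormedSpace ℝ V] {C : ConvexCone ℝ V} (hne : (C : Set V).Nonempty) :
    ∃ K : PointedCone ℝ V, (K : Set V) = closure (C : Set V) :=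
  ⟨C.closure.toPointedCone (C.zero_mem_closure hne), rfl⟩

theorem ConvexCone.eq_zero_of_mem_closure_of_neg_mem_closure {V : Type*} [NormedAddCommGroup V]
    [NormedSpace ℝ V] {C : ConvexCone ℝ V} (hne : (C : Set V).Nonempty)
    (hopen : IsOpen (C : Set V)) (hnd : IsNondegenerateSet (C : Set V)) {x : V}
    (hx : x ∈ closure (C : Set V)) (hx' : -x ∈ closure (C : Set V)) : x = 0 := by
  by_contra hx0
  obtain ⟨c, hc⟩ := hne
  refine hnd ⟨c, x, hx0, fun t => ?_⟩
  rcases lt_trichotomy t 0 with ht | rfl | ht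
  · rw [← neg_neg t, neg_smul, ← smul_neg]
    exact C.add_mem_of_mem_closure hopen hc (C.closure.smul_mem (neg_pos.2 ht) hx')
  · simpa using hc
  · exact C.add_mem_of_mem_closure hopen hc (C.closure.smul_mem ht hx)

/-- By compactness, `-u` stays at distance `δ` from `K` for unit `u ∈ K`; but `y - x ∈ K` puts `-x /
‖x‖` within `‖y‖ / ‖x‖` of `K`. -/
theorem PointedCone.isBounded_order_interval {V : Type*} [NormedAddCommGroup V]
    [NormedSpace ℝ V] [FiniteDimensional ℝ V] {K : PointedCone ℝ V} (hK : IsClosed (K : Set V))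
    (hsal : ∀ x ∈ K, -x ∈ K → x = 0) (y : V) : Bornology.IsBounded {x | x ∈ K ∧ y - x ∈ K} := by
  have := FiniteDimensional.proper ℝ V
  have hKne : (K : Set V).Nonempty := ⟨0, zero_mem _⟩
  have hcomp : IsCompact ((K : Set V) ∩ Metric.sphere 0 1) := (isCompact_sphere _ _).inter_left hK
  have hδ : ∃ δ > 0, ∀ u ∈ (K : Set V) ∩ Metric.sphere 0 1, δ ≤ Metric.infDist (-u) K := by
    rcases ((K : Set V) ∩ Metric.sphere 0 1).eq_empty_or_nonempty with h | h
    · exact ⟨1, one_pos, by simp [h]⟩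
    · obtain ⟨u, hu, hmin⟩ := hcomp.exists_isMinOn h
        (f := fun u => Metric.infDist (-u) (K : Set V))
        ((Metric.continuous_infDist_pt _).comp continuous_neg).continuousOn
      refine ⟨_, (hK.notMem_iff_infDist_pos hKne).1 fun hneg => ?_, fun v hv => hmin hv⟩
      have h0 := hsal u hu.1 hneg
      have := hu.2
      simp [h0] at this
  obtain ⟨δ, hδ0, hδ⟩ := hδ
  refine isBounded_iff_forall_norm_le.2 ⟨‖y‖ / δ, fun x ⟨hx, hyx⟩ => ?_⟩
  rcases eq_or_ne x 0 with rfl | hx0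
  · rw [norm_zero]
    positivity
  have hn : 0 < ‖x‖ := norm_pos_iff.2 hx0
  have h1 := hδ (‖x‖⁻¹ • x) ⟨K.smul_mem (inv_nonneg.2 hn.le) hx, by
    rw [mem_sphere_zero_iff_norm, norm_smul, norm_inv, norm_norm, inv_mul_cancel₀ hn.ne']⟩
  have h2 : Metric.infDist (-(‖x‖⁻¹ • x)) (K : Set V) ≤ ‖x‖⁻¹ * ‖y‖ := by
    refine (Metric.infDist_le_dist_of_mem (K.smul_mem (inv_nonneg.2 hn.le) hyx)).trans ?_
    rw [dist_comm, dist_eq_norm, smul_sub, sub_neg_eq_add, sub_add_cancel, norm_smul, norm_inv,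
      norm_norm]
  rw [le_div_iff₀ hδ0]
  have h3 := h1.trans h2
  rw [← div_eq_inv_mul, le_div_iff₀ hn] at h3
  linarith

/-- If `h z ≤ z`, then `h` maps the finite set of lattice points of `[0, z]` injectively into
itself, so `z = h x` with `x ≤ z`. Then `z ≤ h z`, and salience concludes. -/
theorem PointedCone.map_eq_self_of_sub_mem {V : Type*} [NormedAddCommGroup V] [NormedSpace ℝ V]
    [FiniteDimensional ℝ V] {K : PointedCone ℝ V} (hK : IsClosed (K : Set V))
    (hsal : ∀ x ∈ K, -x ∈ K → x = 0) (L : Submodule ℤ V) [DiscreteTopology L] {h : V →ₗ[ℝ] V}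
    (hinj : Function.Injective h) (hhK : ∀ x ∈ K, h x ∈ K) (hhL : ∀ x ∈ L, h x ∈ L) {z : V}
    (hzK : z ∈ K) (hzL : z ∈ L) (hz : z - h z ∈ K) : h z = z := by
  have hfin : ({x | x ∈ K ∧ z - x ∈ K} ∩ L).Finite :=
    L.finite_inter_of_isBounded (isBounded_order_interval hK hsal z)
  have hsub : h '' ({x | x ∈ K ∧ z - x ∈ K} ∩ L) ⊆ {x | x ∈ K ∧ z - x ∈ K} ∩ L := by
    rintro _ ⟨x, ⟨⟨hxK, hzx⟩, hxL⟩, rfl⟩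
    refine ⟨⟨hhK x hxK, ?_⟩, hhL x hxL⟩
    rw [← sub_add_sub_cancel z (h z) (h x), ← map_sub]
    exact add_mem hz (hhK _ hzx)
  have heq := Set.eq_of_subset_of_ncard_le hsub (Set.ncard_image_of_injective _ hinj).ge hfin
  have hmem : z ∈ h '' ({x | x ∈ K ∧ z - x ∈ K} ∩ L) := by
    rw [heq]
    exact ⟨⟨hzK, by simp⟩, hzL⟩
  obtain ⟨x, ⟨⟨-, hzx⟩, -⟩, hx⟩ := hmem
  refine (sub_eq_zero.1 (hsal _ hz ?_)).symm
  have := hhK _ hzx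
  rwa [map_sub, hx, ← neg_sub] at this

open PointedCone in
-- Dickson's lemma for the integer parts of the coefficients; the fractional remainders are bounded
-- lattice points, hence finitely many.
theorem PointedCone.partiallyWellOrderedOn_inter_lattice {V : Type*} [NormedAddCommGroup V]
    [NormedSpace ℝ V] [FiniteDimensional ℝ V] {K : PointedCone ℝ V} (L : Submodule ℤ V)
    [DiscreteTopology L] {S : Set V} (hS : S.Finite) (hSK : S ⊆ K) (hSL : S ⊆ L) :
    ((hull ℝ S : Set V) ∩ L).PartiallyWellOrderedOn fun x y => y - x ∈ K := by
  have := hS.fintype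
  set B : Set V := Metric.closedBall 0 (∑ s : S, ‖(s : V)‖)
  have hF : (B ∩ L).Finite := L.finite_inter_of_isBounded Metric.isBounded_closedBall
  have h1 : (Set.univ : Set (S → ℕ)).PartiallyWellOrderedOn (· ≤ ·) :=
    Set.isPWO_of_wellQuasiOrderedLE _
  have h2 : (B ∩ L).PartiallyWellOrderedOn (· = ·) := hF.partiallyWellOrderedOn
  have h3 := (h1.prod h2).image_of_monotone_on (r' := fun x y => y - x ∈ K)
    (f := fun p : (S → ℕ) × V => ∑ s, p.1 s • (s : V) + p.2) (by
      rintro ⟨m, e⟩ - ⟨m', e'⟩ - ⟨hm, he⟩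
      simp only at hm he
      simp only [he, add_sub_add_right_eq_sub, ← Finset.sum_sub_distrib]
      refine sum_mem fun s _ => ?_
      rw [← Nat.cast_smul_eq_nsmul ℝ, ← Nat.cast_smul_eq_nsmul ℝ (m s), ← sub_smul]
      exact PointedCone.smul_mem _ (sub_nonneg.2 (by exact_mod_cast hm s)) (hSK s.2))
  refine h3.mono ?_
  rintro x ⟨hx, hxL⟩
  rw [← Subtype.range_coe (s := S), SetLike.mem_coe, PointedCone.hull,
    Submodule.mem_span_range_iff_exists_fun] at hx
  obtain ⟨c, rfl⟩ := hx
  have hint : ∑ s : S, ⌊(c s : ℝ)⌋₊ • (s : V) ∈ L := sum_mem fun s _ => nsmul_mem (hSL s.2) _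
  refine ⟨(fun s => ⌊(c s : ℝ)⌋₊, _), ⟨trivial, ?_, sub_mem hxL hint⟩, add_sub_cancel _ _⟩
  rw [mem_closedBall_zero_iff, ← Finset.sum_sub_distrib]
  refine (norm_sum_le _ _).trans (Finset.sum_le_sum fun s _ => ?_)
  have key : c s • (s : V) - ⌊(c s : ℝ)⌋₊ • (s : V) = ((c s : ℝ) - ⌊(c s : ℝ)⌋₊) • (s : V) := by
    rw [sub_smul, Nat.cast_smul_eq_nsmul]
    rfl
  have hfl := Nat.floor_le (c s).2
  have hfl' := Nat.lt_floor_add_one (c s : ℝ)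
  rw [key, norm_smul, Real.norm_eq_abs, abs_of_nonneg (by linarith)]
  exact mul_le_of_le_one_left (norm_nonneg _) (by linarith)

/-! ### Finite index criteria and stabilizers of a lattice -/

theorem Subgroup.relIndex_ne_zero_of_finite_image {G β : Type*} [Group G] {H K : Subgroup G}
    (f : G → β) (hfin : (f '' H).Finite)
    (hf : ∀ g ∈ H, ∀ h ∈ H, f g = f h → g⁻¹ * h ∈ K) : K.relIndex H ≠ 0 := by
  have := hfin.to_subtype
  have : Finite (H ⧸ K.subgroupOf H) := by
    refine Finite.of_injective
      (fun q => (⟨f (q.out : H), Set.mem_image_of_mem f q.out.2⟩ : f '' (H : Set G))) ?_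
    intro a b hab
    rw [← a.out_eq, ← b.out_eq, QuotientGroup.eq, Subgroup.mem_subgroupOf]
    exact hf _ a.out.2 _ b.out.2 (congrArg Subtype.val hab)
  exact Subgroup.index_ne_zero_of_finite

theorem Subgroup.exists_finite_transversal_of_relIndex_ne_zero {G : Type*} [Group G]
    {H K : Subgroup G} (h : K.relIndex H ≠ 0) :
    ∃ F : Set G, F.Finite ∧ F ⊆ H ∧ ∀ g ∈ H, ∃ f ∈ F, ∃ k ∈ K, g = k * f := by
  have : (K.subgroupOf H).FiniteIndex := ⟨h⟩
  have : Finite (H ⧸ K.subgroupOf H) := Subgroup.finite_quotient_of_finiteIndex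
  refine ⟨Set.range fun q : H ⧸ K.subgroupOf H => ((q.out : H) : G)⁻¹, Set.finite_range _, ?_,
    fun g hg => ?_⟩
  · rintro _ ⟨q, rfl⟩
    exact inv_mem q.out.2
  · set q : H ⧸ K.subgroupOf H := QuotientGroup.mk ⟨g, hg⟩⁻¹
    refine ⟨_, ⟨q, rfl⟩, g * q.out, ?_, by group⟩
    have hq : (q.out : H)⁻¹ * ⟨g, hg⟩⁻¹ ∈ K.subgroupOf H :=
      QuotientGroup.eq.1 q.out_eq
    have := inv_mem hq
    rw [mul_inv_rev, inv_inv, inv_inv] at this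
    exact this

open Pointwise in
/-- The group of linear automorphisms that stabilize both `X` and `Y`. -/
def pairStabilizer {V : Type*} [AddCommGroup V] [Module ℝ V] (X Y : Set V) :
    Subgroup (V ≃ₗ[ℝ] V) :=
  MulAction.stabilizer (V ≃ₗ[ℝ] V) X ⊓ MulAction.stabilizer (V ≃ₗ[ℝ] V) Y

theorem mem_pairStabilizer {V : Type*} [AddCommGroup V] [Module ℝ V] {X Y : Set V}
    {g : V ≃ₗ[ℝ] V} : g ∈ pairStabilizer X Y ↔ g '' X = X ∧ g '' Y = Y :=
  Iff.rfl

open PointedCone in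
theorem relIndex_pairStabilizer_ne_zero_of_cover {V : Type*} [NormedAddCommGroup V]
    [NormedSpace ℝ V] [FiniteDimensional ℝ V] {C : ConvexCone ℝ V} (hne : (C : Set V).Nonempty)
    (hopen : IsOpen (C : Set V)) (hnd : IsNondegenerateSet (C : Set V)) (L : Submodule ℤ V)
    [DiscreteTopology L] [IsZLattice ℝ L] {Γ : Subgroup (V ≃ₗ[ℝ] V)}
    (hΓ : Γ ≤ pairStabilizer (C : Set V) L) {S : Set V} (hS : S.Finite)
    (hSC : S ⊆ closure (C : Set V)) (hSL : S ⊆ L)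
    (hcover : ∀ x ∈ C, x ∈ L → ∃ γ ∈ Γ, γ x ∈ hull ℝ S) :
    Γ.relIndex (pairStabilizer (C : Set V) L) ≠ 0 := by
  obtain ⟨K, hKC⟩ := C.exists_pointedCone_coe_eq_closure hne
  have hK : IsClosed (K : Set V) := hKC ▸ isClosed_closure
  have hmemK : ∀ x, x ∈ K ↔ x ∈ closure (C : Set V) := fun x => by rw [← hKC]; rfl
  have hCK : ∀ x ∈ C, x ∈ K := fun x hx => (hmemK x).2 (subset_closure hx)
  have hsal : ∀ x ∈ K, -x ∈ K → x = 0 := fun x hx hx' =>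
    C.eq_zero_of_mem_closure_of_neg_mem_closure hne hopen hnd ((hmemK _).1 hx) ((hmemK _).1 hx')
  set G := pairStabilizer (C : Set V) (L : Set V)
  have hGC : ∀ g ∈ G, ∀ x ∈ C, g x ∈ C := fun g hg x hx => hg.1.subset ⟨x, hx, rfl⟩
  have hGL : ∀ g ∈ G, ∀ x ∈ L, g x ∈ L := fun g hg x hx => hg.2.subset ⟨x, hx, rfl⟩
  have hGK : ∀ g ∈ G, ∀ x ∈ K, g x ∈ K := fun g hg x hx => (hmemK _).2 <|
    map_mem_closure (f := g) (LinearMap.continuous_of_finiteDimensional (g : V →ₗ[ℝ] V))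
      ((hmemK _).1 hx) (hGC g hg)
  obtain ⟨T, hT, hTL⟩ := Submodule.fg_def.1 (ZLattice.FG ℝ L)
  obtain ⟨r, hr⟩ := isBounded_iff_forall_norm_le.1 hT.isBounded
  -- The maximum with `0` makes `w = 0` admissible, so that `x ∈ C`.
  obtain ⟨x, hxL, hxC⟩ := C.exists_mem_lattice_forall_add_mem hne hopen L (max r 0)
  have hx0 : x ∈ C := by simpa using hxC 0 (by simp)
  set X := x + x
  have hXC : X ∈ C := C.add_mem hx0 hx0
  have hXL : X ∈ L := add_mem hxL hxL
  -- the interval below `X` contains a spanning set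
  set I : V → Set V := fun y => {a | a ∈ K ∧ y - a ∈ K} ∩ L
  have hI : ∀ y, (I y).Finite := fun y =>
    L.finite_inter_of_isBounded (isBounded_order_interval hK hsal y)
  have hspan : Submodule.span ℝ (I X) = ⊤ := by
    rw [eq_top_iff, ← IsZLattice.span_top (K := ℝ) (L := L), Submodule.span_le, ← hTL]
    have hTI : T ⊆ Submodule.span ℝ (I X) := by
      intro t ht
      have h1 : x + t ∈ I X := by
        refine ⟨⟨hCK _ (hxC t ((hr t ht).trans (le_max_left _ _))), ?_⟩,
          add_mem hxL (hTL ▸ Submodule.subset_span ht)⟩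
        have := hCK _ (hxC (-t) (by rw [norm_neg]; exact (hr t ht).trans (le_max_left _ _)))
        convert this using 1
        simp only [X]
        abel
      have h2 : x ∈ I X := ⟨⟨hCK x hx0, by simpa [X] using hCK x hx0⟩, hxL⟩
      simpa using sub_mem (Submodule.subset_span h1) (Submodule.subset_span (R := ℝ) h2)
    exact (Submodule.span_le (p := (Submodule.span ℝ (I X)).restrictScalars ℤ)).2 hTI
  -- the part of the orbit of `X` in the cone is an antichain
  set O : Set V := {y | ∃ g ∈ G, g X = y} ∩ ((hull ℝ S : Set V) ∩ L)
  have hO : O.Finite := by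
    refine IsAntichain.finite_of_partiallyWellOrderedOn (r := fun x y => y - x ∈ K) ?_
      ((partiallyWellOrderedOn_inter_lattice (K := K) L hS (hKC ▸ hSC) hSL).mono
        Set.inter_subset_right)
    rintro _ ⟨⟨g, hg, rfl⟩, -⟩ _ ⟨⟨g', hg', rfl⟩, -⟩ hneq hle
    have hh : g * g'⁻¹ ∈ G := mul_mem hg (inv_mem hg')
    have hhX : (g * g'⁻¹) (g' X) = g X := congrArg g (g'.symm_apply_apply X)
    refine hneq (hhX.symm.trans ?_)
    exact map_eq_self_of_sub_mem (h := ((g * g'⁻¹ : V ≃ₗ[ℝ] V) : V →ₗ[ℝ] V)) hK hsal L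
      (g * g'⁻¹ : V ≃ₗ[ℝ] V).injective (hGK _ hh) (hGL _ hh) (hGK _ hg' _ (hCK _ hXC))
      (hGL _ hg' _ hXL) (by rw [LinearEquiv.coe_coe, hhX]; exact hle)
  have hF : {g | g ∈ G ∧ g X ∈ hull ℝ S}.Finite := by
    have := (hI X).to_subtype
    -- As `I X` spans, `g` is determined by its restriction to `I X`, which lands in the finite set
    -- `I (g X)`.
    refine Set.Finite.of_injOn (f := fun (g : V ≃ₗ[ℝ] V) (a : I X) => g a)
      (t := Set.univ.pi fun _ => ⋃ y ∈ O, I y) ?_ ?_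
      (Set.Finite.pi fun _ => hO.biUnion fun y _ => hI y)
    · rintro g ⟨hg, hgX⟩ ⟨a, ⟨haK, haX⟩, haL⟩ -
      refine Set.mem_biUnion (x := g X) ⟨⟨g, hg, rfl⟩, hgX, hGL g hg X hXL⟩
        ⟨⟨hGK g hg a haK, ?_⟩, hGL g hg a haL⟩
      rw [← map_sub]
      exact hGK g hg _ haX
    · intro g _ h _ hgh
      exact LinearEquiv.toLinearMap_injective
        (LinearMap.ext_on hspan fun a ha => congrFun hgh ⟨a, ha⟩)
  have hex : ∀ g : V ≃ₗ[ℝ] V, ∃ γ ∈ Γ, g ∈ G → γ (g X) ∈ hull ℝ S := fun g => by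
    by_cases hg : g ∈ G
    · obtain ⟨γ, hγ, h⟩ := hcover (g X) (hGC g hg X hXC) (hGL g hg X hXL)
      exact ⟨γ, hγ, fun _ => h⟩
    · exact ⟨1, one_mem _, fun h => absurd h hg⟩
  choose γ hγ hγX using hex
  -- Inverses appear because the criterion compares `g⁻¹ * h`: equal values place `g` and `h` in one
  -- left coset of `Γ`.
  refine Subgroup.relIndex_ne_zero_of_finite_image (fun g => γ g⁻¹ * g⁻¹) (hF.subset ?_) ?_
  · rintro _ ⟨g, hg, rfl⟩
    exact ⟨mul_mem (hΓ (hγ _)) (inv_mem hg), hγX _ (inv_mem hg)⟩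
  · intro g _ h _ hgh
    have : g⁻¹ * h = (γ g⁻¹)⁻¹ * γ h⁻¹ := by
      rw [eq_inv_mul_iff_mul_eq, ← mul_assoc]
      rw [hgh, inv_mul_cancel_right]
    rw [this]
    exact mul_mem (inv_mem (hγ _)) (hγ _)

/-- For `g` stabilizing `L`, the lattice `g L'` lies between `N L` and `M⁻¹ L`. Its trace on a ball
of radius `N R`, with `R` a covering radius of `L`, determines it, and only finitely many traces
occur. -/
theorem relIndex_pairStabilizer_ne_zero {V : Type*} [NormedAddCommGroup V] [NormedSpace ℝ V]
    [FiniteDimensional ℝ V] [Module ℚ V] {VQ : Submodule ℚ V} (hVQ : IsRationalStructure VQ)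
    {L L' : Submodule ℤ V} (hL : IsRationalLattice VQ L) (hL' : IsRationalLattice VQ L')
    (X : Set V) : (pairStabilizer X (L' : Set V)).relIndex (pairStabilizer X (L : Set V)) ≠ 0 := by
  have := hL.discrete
  have := hL.isZLattice
  obtain ⟨M, hM, hML⟩ := hL.exists_nsmul_mem_of_fg hVQ hL'.fg hL'.subset
  obtain ⟨N, hN, hNL⟩ := hL'.exists_nsmul_mem_of_fg hVQ hL.fg hL.subset
  obtain ⟨R, hR, hcov⟩ := ZLattice.exists_norm_sub_le L
  set B : Set V := Metric.closedBall 0 (N * R)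
  have hMR : (M : ℝ) ≠ 0 := Nat.cast_ne_zero.2 hM.ne'
  have hNR : (N : ℝ) ≠ 0 := Nat.cast_ne_zero.2 hN.ne'
  have hfin : {v | v ∈ B ∧ M • v ∈ L}.Finite := by
    refine Set.Finite.of_injOn (f := fun v : V => (M : ℝ) • v)
      (t := Metric.closedBall 0 (M * (N * R)) ∩ L) ?_
      (smul_right_injective V hMR).injOn (L.finite_inter_of_isBounded Metric.isBounded_closedBall)
    rintro v ⟨hvB, hvL⟩
    refine ⟨?_, by rwa [← Nat.cast_smul_eq_nsmul ℝ] at hvL⟩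
    rw [mem_closedBall_zero_iff] at hvB ⊢
    rw [norm_smul, Real.norm_natCast]
    gcongr
  have hgL : ∀ g ∈ pairStabilizer X (L : Set V), ∀ x ∈ L, g x ∈ L := fun g hg x hx =>
    hg.2.subset ⟨x, hx, rfl⟩
  have hNg : ∀ g ∈ pairStabilizer X (L : Set V), ∀ x ∈ L, g⁻¹ (N • x) ∈ L' := fun g hg x hx => by
    rw [map_nsmul]
    exact hNL _ (hgL _ (inv_mem hg) x hx)
  refine Subgroup.relIndex_ne_zero_of_finite_image (fun g => {v | v ∈ B ∧ g⁻¹ v ∈ L'})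
    (hfin.finite_subsets.subset ?_) ?_
  · rintro _ ⟨g, hg, rfl⟩ v ⟨hvB, hv⟩
    refine ⟨hvB, ?_⟩
    have := hgL g hg _ (hML _ hv)
    rw [map_nsmul] at this
    rwa [show g (g⁻¹ v) = v from g.apply_symm_apply v] at this
  · have key : ∀ g ∈ pairStabilizer X (L : Set V), ∀ h ∈ pairStabilizer X (L : Set V),
        {v | v ∈ B ∧ g⁻¹ v ∈ L'} = {v | v ∈ B ∧ h⁻¹ v ∈ L'} →
        ∀ x ∈ L', (h⁻¹ * g) x ∈ L' := by
      intro g hg h hh hgh x hx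
      -- Subtracting an element of `N L`, which lies in both `g L'` and `h L'`, brings `g x` into
      -- the ball.
      obtain ⟨l, hl, hlR⟩ := hcov ((N : ℝ)⁻¹ • g x)
      have hmem : g x - N • l ∈ {v | v ∈ B ∧ g⁻¹ v ∈ L'} := by
        refine ⟨?_, ?_⟩
        · have : g x - N • l = (N : ℝ) • ((N : ℝ)⁻¹ • g x - l) := by
            rw [smul_sub, smul_inv_smul₀ hNR, Nat.cast_smul_eq_nsmul]
          rw [mem_closedBall_zero_iff, this, norm_smul, Real.norm_natCast]
          gcongr
        · rw [map_sub, show g⁻¹ (g x) = x from g.symm_apply_apply x]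
          exact sub_mem hx (hNg g hg l hl)
      rw [hgh] at hmem
      have := add_mem hmem.2 (hNg h hh l hl)
      rwa [← map_add, sub_add_cancel] at this
    intro g hg h hh hgh
    have hX : (g⁻¹ * h) '' X = X := (mul_mem (inv_mem hg) hh).1
    refine ⟨hX, Set.Subset.antisymm ?_ fun x hx => ?_⟩
    · rintro _ ⟨x, hx, rfl⟩
      exact key h hh g hg hgh.symm x hx
    · refine ⟨(h⁻¹ * g) x, key g hg h hh hgh x hx, ?_⟩
      change (g⁻¹ * h * (h⁻¹ * g)) x = x
      group
      rfl

theorem commensurable_pairStabilizer {V : Type*} [NormedAddCommGroup V] [NormedSpace ℝ V]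
    [FiniteDimensional ℝ V] [Module ℚ V] {VQ : Submodule ℚ V} (hVQ : IsRationalStructure VQ)
    {L L' : Submodule ℤ V} (hL : IsRationalLattice VQ L) (hL' : IsRationalLattice VQ L')
    (X : Set V) :
    Subgroup.Commensurable (pairStabilizer X (L : Set V)) (pairStabilizer X (L' : Set V)) :=
  ⟨relIndex_pairStabilizer_ne_zero hVQ hL' hL X, relIndex_pairStabilizer_ne_zero hVQ hL hL' X⟩

/-! ### Groups of polyhedral type inside lattice stabilizers -/

open PointedCone in
-- Natural multiples preserve rational points and shrinking towards `0` is convexity, so the convex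
-- hull is already a cone.
theorem coe_hull_eq_rationalHull {V : Type*} [NormedAddCommGroup V] [NormedSpace ℝ V]
    [Module ℚ V] (VQ : Submodule ℚ V) {C : ConvexCone ℝ V} (hne : (C : Set V).Nonempty) :
    (hull ℝ (closure (C : Set V) ∩ VQ) : Set V) = rationalHull VQ C := by
  obtain ⟨K, hKC⟩ := C.exists_pointedCone_coe_eq_closure hne
  rw [rationalHull, ← hKC]
  set X : Set V := (K : Set V) ∩ VQ
  have hconv : Convex ℝ (convexHull ℝ X) := convex_convexHull ℝ X
  have hzero : (0 : V) ∈ convexHull ℝ X :=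
    subset_convexHull ℝ X ⟨zero_mem _, zero_mem _⟩
  have hnsmul : ∀ n : ℕ, ∀ x ∈ convexHull ℝ X, (n : ℝ) • x ∈ convexHull ℝ X := by
    intro n x hx
    refine convexHull_min (t := (LinearMap.lsmul ℝ V (n : ℝ)) ⁻¹' convexHull ℝ X)
      (fun y hy => subset_convexHull ℝ X ?_) (hconv.linear_preimage _) hx
    rw [LinearMap.lsmul_apply, Nat.cast_smul_eq_nsmul]
    exact ⟨nsmul_mem hy.1 n, nsmul_mem hy.2 n⟩
  have hsmul : ∀ c : ℝ, 0 ≤ c → ∀ x ∈ convexHull ℝ X, c • x ∈ convexHull ℝ X := by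
    intro c hc x hx
    obtain ⟨n, hn⟩ := exists_nat_gt c
    have hn0 : (0 : ℝ) < n := hc.trans_lt hn
    have := hconv.smul_mem_of_zero_mem hzero (hnsmul n x hx)
      (t := c / n) ⟨by positivity, (div_le_one hn0).2 hn.le⟩
    rwa [smul_smul, div_mul_cancel₀ _ hn0.ne'] at this
  refine Set.Subset.antisymm (fun x hx => ?_) (convexHull_min subset_hull (PointedCone.convex _))
  induction hx using Submodule.span_induction with
  | mem x hx => exact subset_convexHull ℝ X hx
  | zero => exact hzero
  | add x y _ _ hx hy =>
    have := hsmul 2 zero_le_two _ (hconv hx hy (a := 1 / 2) (b := 1 / 2) (by norm_num)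
      (by norm_num) (by norm_num))
    rw [← smul_add, smul_smul] at this
    norm_num at this
    exact this
  | smul c x _ hx => exact hsmul c c.2 x hx

theorem image_rationalHull {V : Type*} [NormedAddCommGroup V] [NormedSpace ℝ V]
    [FiniteDimensional ℝ V] [Module ℚ V] {VQ : Submodule ℚ V} {C : ConvexCone ℝ V}
    {g : V ≃ₗ[ℝ] V} (hQ : g '' (VQ : Set V) = VQ) (hC : g '' (C : Set V) = C) :
    g '' rationalHull VQ C = rationalHull VQ C := by
  have hcl : g '' closure (C : Set V) = closure (C : Set V) := by
    have := g.toContinuousLinearEquiv.image_closure (C : Set V)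
    rw [LinearEquiv.coe_toContinuousLinearEquiv'] at this
    rw [this, hC]
  rw [rationalHull]
  have := LinearMap.image_convexHull (g : V →ₗ[ℝ] V) (closure (C : Set V) ∩ (VQ : Set V))
  rw [LinearEquiv.coe_coe] at this
  rw [this, Set.image_inter g.injective, hcl, hQ]

open PointedCone in
theorem IsPolyhedralType.exists_commensurable_pairStabilizer {V : Type*} [NormedAddCommGroup V]
    [NormedSpace ℝ V] [FiniteDimensional ℝ V] [Module ℚ V] {VQ : Submodule ℚ V}
    (hVQ : IsRationalStructure VQ) {C : ConvexCone ℝ V} (hne : (C : Set V).Nonempty)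
    (hopen : IsOpen (C : Set V)) (hnd : IsNondegenerateSet (C : Set V))
    {Γ : Subgroup (V ≃ₗ[ℝ] V)} (hΓ : IsPolyhedralType VQ C Γ) :
    ∃ L : Submodule ℤ V, IsRationalLattice VQ L ∧
      Subgroup.Commensurable Γ (pairStabilizer (C : Set V) (L : Set V)) := by
  obtain ⟨hΓC, ⟨L, hL, hΓL⟩, P, hP, hPsub, hPcov⟩ := hΓ
  have := hL.discrete
  have := hL.isZLattice
  have hle : Γ ≤ pairStabilizer (C : Set V) (L : Set V) := fun γ hγ => ⟨hΓC γ hγ, hΓL γ hγ⟩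
  refine ⟨L, hL, ?_, ?_⟩
  swap
  · rw [Subgroup.relIndex_eq_one.2 hle]
    exact one_ne_zero
  obtain ⟨E, hE, rfl⟩ := hP.exists_fg
  obtain ⟨S₀, rfl⟩ := hE
  rw [← coe_hull_eq_rationalHull VQ hne] at hPsub hPcov
  -- The finitely many generators of the polyhedral cone involve only finitely many rational points;
  -- these are scaled into `L` below.
  obtain ⟨T, hTsub, hT⟩ := Submodule.subset_span_finite_of_subset_span
    (subset_hull.trans hPsub)
  have hN : ∀ t : V, ∃ N : ℕ, 0 < N ∧ (t ∈ VQ → N • t ∈ L) := fun t => by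
    by_cases ht : t ∈ VQ
    · obtain ⟨N, hN, h⟩ := hL.exists_nsmul_mem hVQ ht
      exact ⟨N, hN, fun _ => h⟩
    · exact ⟨1, one_pos, fun h => absurd h ht⟩
  choose N hN hNL using hN
  refine relIndex_pairStabilizer_ne_zero_of_cover hne hopen hnd L hle
    (S := (fun t => N t • t) '' (T : Set V)) (T.finite_toSet.image _) ?_ ?_ ?_
  · rintro _ ⟨t, ht, rfl⟩
    have := C.closure.smul_mem (Nat.cast_pos.2 (hN t)) (hTsub ht).1
    rwa [Nat.cast_smul_eq_nsmul] at this
  · rintro _ ⟨t, ht, rfl⟩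
    exact hNL t (hTsub ht).2
  · intro x hxC hxL
    have hx : x ∈ ⋃ γ ∈ Γ, γ '' (hull ℝ (S₀ : Set V) : Set V) := by
      rw [hPcov]
      exact subset_hull ⟨subset_closure hxC, hL.subset hxL⟩
    simp only [Set.mem_iUnion] at hx
    obtain ⟨γ, hγ, p, hp, rfl⟩ := hx
    refine ⟨γ⁻¹, inv_mem hγ, ?_⟩
    rw [show γ⁻¹ (γ p) = p from γ.symm_apply_apply p]
    refine (Submodule.span_le.2 hT).trans (Submodule.span_le.2 fun t ht => ?_) hp
    have h0 : (N t : ℝ) ≠ 0 := Nat.cast_ne_zero.2 (hN t).ne'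
    have := PointedCone.smul_mem (hull ℝ ((fun t => N t • t) '' (T : Set V)))
      (inv_nonneg.2 (Nat.cast_nonneg (N t))) (subset_hull ⟨t, ht, rfl⟩)
    beta_reduce at this
    rwa [← Nat.cast_smul_eq_nsmul ℝ (N t) t, inv_smul_smul₀ h0] at this

/-! ### Transfer to a commensurable group -/

theorem IsRationalLattice.of_fg {V : Type*} [NormedAddCommGroup V] [NormedSpace ℝ V]
    [FiniteDimensional ℝ V] [Module ℚ V] {VQ : Submodule ℚ V} (hVQ : IsRationalStructure VQ)
    {L M : Submodule ℤ V} (hL : IsRationalLattice VQ L) (hM : M.FG) (hMQ : (M : Set V) ⊆ VQ)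
    (hLM : L ≤ M) : IsRationalLattice VQ M := by
  have := hL.discrete
  have := hL.isZLattice
  obtain ⟨N, hN, hNL⟩ := hL.exists_nsmul_mem_of_fg hVQ hM hMQ
  have hdisc : DiscreteTopology M := by
    -- Multiplication by `N` embeds `M` in the discrete `L`.
    refine DiscreteTopology.of_continuous_injective (β := L)
      (f := fun x : M => (⟨N • (x : V), hNL x x.2⟩ : L)) (by fun_prop) fun x y hxy => ?_
    have h := congrArg Subtype.val hxy
    simp only [← Nat.cast_smul_eq_nsmul ℝ] at h
    exact Subtype.ext (smul_right_injective V (Nat.cast_ne_zero.2 hN.ne' : (N : ℝ) ≠ 0) h)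
  refine ⟨hMQ, hdisc, ⟨?_⟩⟩
  rw [eq_top_iff, ← IsZLattice.span_top (K := ℝ) (L := L)]
  exact Submodule.span_mono hLM

theorem StabilizesSet.of_forall_mem {V : Type*} [AddCommGroup V] [Module ℝ V]
    {Γ : Subgroup (V ≃ₗ[ℝ] V)} {X : Set V} (h : ∀ γ ∈ Γ, ∀ x ∈ X, γ x ∈ X) :
    StabilizesSet Γ X := by
  intro γ hγ
  refine Set.Subset.antisymm (Set.image_subset_iff.2 (h γ hγ)) fun x hx => ?_
  exact ⟨γ⁻¹ x, h _ (inv_mem hγ) x hx, γ.apply_symm_apply x⟩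

/-- Writing `g⁻¹ = k * f` with `k ∈ Γ` gives `g L = f⁻¹ L`, so the `Γ'`-translates of `L` are finite
in number and their sum is stable. -/
theorem IsRationalLattice.exists_stabilizesSet {V : Type*} [NormedAddCommGroup V]
    [NormedSpace ℝ V] [FiniteDimensional ℝ V] [Module ℚ V] {VQ : Submodule ℚ V}
    (hVQ : IsRationalStructure VQ) {L : Submodule ℤ V} (hL : IsRationalLattice VQ L)
    {Γ Γ' : Subgroup (V ≃ₗ[ℝ] V)} (hΓL : StabilizesSet Γ (L : Set V))
    (hΓ'Q : StabilizesSet Γ' (VQ : Set V)) (hindex : Γ.relIndex Γ' ≠ 0) :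
    ∃ M : Submodule ℤ V, IsRationalLattice VQ M ∧ StabilizesSet Γ' (M : Set V) := by
  obtain ⟨F, hF, hFΓ', hcov⟩ := Subgroup.exists_finite_transversal_of_relIndex_ne_zero hindex
  let φ : (V ≃ₗ[ℝ] V) → Submodule ℤ V :=
    fun g => L.map (g : V →ₗ[ℝ] V).toAddMonoidHom.toIntLinearMap
  have hrange : ∀ g ∈ Γ', ∃ f ∈ F, φ g ≤ φ f⁻¹ := by
    intro g hg
    obtain ⟨f, hf, k, hk, hgk⟩ := hcov g⁻¹ (inv_mem hg)
    refine ⟨f, hf, ?_⟩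
    rintro _ ⟨l, hl, rfl⟩
    refine ⟨k⁻¹ l, (hΓL _ (inv_mem hk)).subset ⟨l, hl, rfl⟩, ?_⟩
    change (f⁻¹ * k⁻¹) l = g l
    rw [← mul_inv_rev, ← hgk, inv_inv]
  have hmono : ∀ g ∈ Γ', φ g ≤ ⨆ f : F, φ (f : V ≃ₗ[ℝ] V)⁻¹ := by
    intro g hg
    obtain ⟨f, hf, hle⟩ := hrange g hg
    exact hle.trans (le_iSup (fun f : F => φ (f : V ≃ₗ[ℝ] V)⁻¹) ⟨f, hf⟩)
  have := hF.to_subtype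
  refine ⟨⨆ f : F, φ (f : V ≃ₗ[ℝ] V)⁻¹, hL.of_fg hVQ
    (Submodule.fg_iSup _ fun f => hL.fg.map _) ?_ ?_, .of_forall_mem fun γ hγ => ?_⟩
  · have : (⨆ f : F, φ (f : V ≃ₗ[ℝ] V)⁻¹) ≤ VQ.restrictScalars ℤ := by
      refine iSup_le fun f => ?_
      rintro _ ⟨l, hl, rfl⟩
      exact (hΓ'Q _ (inv_mem (hFΓ' f.2))).subset ⟨l, hL.subset hl, rfl⟩
    exact this
  · exact fun l hl => hmono 1 (one_mem _) ⟨l, hl, rfl⟩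
  · have : (⨆ f : F, φ (f : V ≃ₗ[ℝ] V)⁻¹) ≤ (⨆ f : F, φ (f : V ≃ₗ[ℝ] V)⁻¹).comap
        (γ : V →ₗ[ℝ] V).toAddMonoidHom.toIntLinearMap := by
      refine iSup_le fun f => ?_
      rintro _ ⟨l, hl, rfl⟩
      exact hmono (γ * (f : V ≃ₗ[ℝ] V)⁻¹) (mul_mem hγ (inv_mem (hFΓ' f.2))) ⟨l, hl, rfl⟩
    exact this

theorem IsPolyhedralType.of_commensurable {V : Type*} [NormedAddCommGroup V]
    [NormedSpace ℝ V] [FiniteDimensional ℝ V] [Module ℚ V] {VQ : Submodule ℚ V}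
    (hVQ : IsRationalStructure VQ) {C : ConvexCone ℝ V} (hne : (C : Set V).Nonempty)
    {Γ Γ' : Subgroup (V ≃ₗ[ℝ] V)} (hΓ : IsPolyhedralType VQ C Γ)
    (hΓ'Q : StabilizesSet Γ' (VQ : Set V)) (hΓ'C : StabilizesSet Γ' (C : Set V))
    (hcomm : Subgroup.Commensurable Γ' Γ) : IsPolyhedralType VQ C Γ' := by
  obtain ⟨hΓC, ⟨L, hL, hΓL⟩, P, hP, hPsub, hPcov⟩ := hΓ
  refine ⟨hΓ'C, hL.exists_stabilizesSet hVQ hΓL hΓ'Q hcomm.2, ?_⟩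
  obtain ⟨E, hE, rfl⟩ := hP.exists_fg
  obtain ⟨F, hF, hFΓ, hcov⟩ := Subgroup.exists_finite_transversal_of_relIndex_ne_zero hcomm.1
  have := hF.to_subtype
  -- Since `Γ ⊆ Γ' F`, the `Γ'`-translates of the `f E` already cover.
  set D : PointedCone ℝ V := ⨆ f : F, E.map ((f : V ≃ₗ[ℝ] V) : V →ₗ[ℝ] V)
  have hD : D.FG := Submodule.fg_iSup _ fun f => Submodule.FG.map _ hE
  have hDsub : (D : Set V) ⊆ rationalHull VQ C := by
    rw [← coe_hull_eq_rationalHull VQ hne] at hPcov ⊢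
    have : D ≤ PointedCone.hull ℝ (closure (C : Set V) ∩ VQ) := by
      refine iSup_le fun f x hx => ?_
      rw [← SetLike.mem_coe, ← hPcov]
      exact Set.mem_biUnion (hFΓ f.2) hx
    exact this
  refine ⟨D, PointedCone.FG.isPolyhedralCone hD, hDsub, Set.Subset.antisymm ?_ fun x hx => ?_⟩
  · refine Set.iUnion₂_subset fun γ hγ => ?_
    rw [← image_rationalHull (hΓ'Q γ hγ) (hΓ'C γ hγ)]
    exact Set.image_mono hDsub
  · rw [← hPcov] at hx
    simp only [Set.mem_iUnion] at hx
    obtain ⟨γ, hγ, p, hp, rfl⟩ := hx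
    obtain ⟨f, hf, k, hk, rfl⟩ := hcov γ hγ
    refine Set.mem_biUnion hk ⟨f p, ?_, rfl⟩
    exact le_iSup (fun f : F => E.map ((f : V ≃ₗ[ℝ] V) : V →ₗ[ℝ] V)) ⟨f, hf⟩ ⟨p, hp, rfl⟩

theorem proposition4 {V : Type*} [NormedAddCommGroup V] [NormedSpace ℝ V] [FiniteDimensional ℝ V]
    [Module ℚ V] (VQ : Submodule ℚ V) (hVQ : IsRationalStructure VQ)
    (C : ConvexCone ℝ V) (hCne : (C : Set V).Nonempty) (hCopen : IsOpen (C : Set V))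
    (hCnd : IsNondegenerateSet (C : Set V))
    (Γ : Subgroup (V ≃ₗ[ℝ] V)) (hΓ : IsPolyhedralType VQ C Γ)
    (Γ' : Subgroup (V ≃ₗ[ℝ] V)) (hΓ'Q : StabilizesSet Γ' (VQ : Set V))
    (hΓ'C : StabilizesSet Γ' (C : Set V)) :
    IsPolyhedralType VQ C Γ' ↔ Subgroup.Commensurable Γ' Γ := by
  refine ⟨fun hΓ' => ?_, hΓ.of_commensurable hVQ hCne hΓ'Q hΓ'C⟩
  obtain ⟨L, hL, h⟩ := hΓ.exists_commensurable_pairStabilizer hVQ hCne hCopen hCnd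
  obtain ⟨L', hL', h'⟩ := hΓ'.exists_commensurable_pairStabilizer hVQ hCne hCopen hCnd
  exact (h'.trans (commensurable_pairStabilizer hVQ hL' hL C)).trans h.symm
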